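/- For complex numbers $a,q$ and an integer $n\ge 0$ write $(a;q)_n=\prod_{i=0}^{n-1}(1-aq^i)$ (so $(a;q)_0=1$), and for $0\le n\le N$ write $$\left[\begin{matrix} N\\n\end{matrix}\right]_{q}=\frac{(q;q)_N}{(q;q)_n\,(q;q)_{N-n}}.$$ **Theorem (finite analogue of Garvan's identity).** Let $N\in\mathbb{N}$ and let $q,z\in\mathbb{C}$ be such that $q^{2k}\neq 1$ for $1\le k\le N$ (which holds in particular whenever $|q|<1$), and $zq^{n}\neq 1$ (that is, $z\neq q^{-n}$ if $q\ne 0$) for $1\le n\le 4N-1$. Then $$\sum_{n=1}^{N}\left[\begin{matrix} N\\n\end{matrix}\right]_{q^2}\frac{(-1)^{n-1}z^nq^{n^2}(q^2;q^2)_{n}}{(zq;q^2)_n\,(1-zq^{2n})} =\sum_{n=1}^{N}\left[\begin{matrix} N\\n\end{matrix}\right]_{q^2}\left(\frac{(q;q)_{2n-2}\,z^{2n-1}q^{n(2n-1)}}{(zq;q)_{2n-1}}+\frac{(q;q)_{2n-1}\,z^{2n}q^{n(2n+1)}}{(zq;q)_{2n}}\right)\frac{(q^{2};q^2)_n}{(zq^{2N+1};q^2)_{n}}.$$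 -/

import Mathlib

/-- The `q`-shifted factorial `(a; q)_n = (1 - a) (1 - a q) ⋯ (1 - a q ^ (n - 1))`,
with `(a; q)_0 = 1`. -/
def qPoch (a q : ℂ) (n : ℕ) : ℂ := ∏ i ∈ Finset.range n, (1 - a * q ^ i)

/-- The `q`-binomial coefficient `(q; q)_N / ((q; q)_n (q; q)_{N - n})` for `0 ≤ n ≤ N`,
and `0` otherwise. -/
noncomputable def qBinom (q : ℂ) (N n : ℕ) : ℂ :=
  if n ≤ N then qPoch q q N / (qPoch q q n * qPoch q q (N - n)) else 0

/-! Creative telescoping in `N`. Let `S N` be either side. Both satisfy the same first-order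
recurrence `(1 - z q^(2(M+1))) S (M+1) - (1 - q^(2(M+1))) S M = c`: by `leftTerm_telescope` and
`rightTerm_telescope`, this combination of summands is a difference `G m - G (m+1)` of a
certificate. The certificates vanish at `m = M + 1` and agree at `m = 0` (`leftCert_zero`), so `c`
is the same on both sides. As `S 0 = 0` and the leading coefficient is nonzero, induction gives
equality. -/

lemma qPoch_zero (a q : ℂ) : qPoch a q 0 = 1 := by simp [qPoch]

lemma qPoch_succ (a q : ℂ) (n : ℕ) : qPoch a q (n + 1) = qPoch a q n * (1 - a * q ^ n) := by
  simp [qPoch, Finset.prod_range_succ]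

lemma qPoch_ne_zero {a q : ℂ} {n : ℕ} (h : ∀ i < n, a * q ^ i ≠ 1) : qPoch a q n ≠ 0 := by
  refine Finset.prod_ne_zero_iff.mpr fun i hi => ?_
  exact sub_ne_zero.mpr (h i (Finset.mem_range.mp hi)).symm

/-- Shifting the base point of a `q`-shifted factorial by one step. -/
lemma qPoch_mul_shift (a q : ℂ) (n : ℕ) :
    qPoch a q n * (1 - a * q ^ n) = (1 - a) * qPoch (a * q) q n := by
  rw [← qPoch_succ, qPoch, Finset.prod_range_succ', mul_comm, qPoch]
  congr 1
  · simp
  · exact Finset.prod_congr rfl fun i _ => by ring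

/-- The product `(1 - q ^ (2 M)) (1 - q ^ (2 (M - 1))) ⋯` with `n` factors. -/
noncomputable def descPoch (q : ℂ) (M n : ℕ) : ℂ :=
  ∏ i ∈ Finset.range n, (1 - q ^ (2 * (M - i)))

lemma descPoch_succ (q : ℂ) (M n : ℕ) :
    descPoch q M (n + 1) = descPoch q M n * (1 - q ^ (2 * (M - n))) := by
  simp [descPoch, Finset.prod_range_succ]

lemma descPoch_succ_left (q : ℂ) (M n : ℕ) :
    (1 - q ^ (2 * (M + 1))) * descPoch q M n =
      descPoch q (M + 1) n * (1 - q ^ (2 * (M + 1 - n))) := by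
  rw [← descPoch_succ, descPoch, descPoch, Finset.prod_range_succ', mul_comm]
  simp

lemma descPoch_mul_qPoch (q : ℂ) {M n : ℕ} (h : n ≤ M) :
    descPoch q M n * qPoch (q ^ 2) (q ^ 2) (M - n) = qPoch (q ^ 2) (q ^ 2) M := by
  induction n with
  | zero => simp [descPoch]
  | succ n ih =>
    rw [← ih (by omega), descPoch_succ]
    obtain ⟨d, rfl⟩ := Nat.exists_eq_add_of_le h
    rw [show n + 1 + d - (n + 1) = d by omega, show n + 1 + d - n = d + 1 by omega, qPoch_succ]
    ring

/-- Clears the denominators of the `q`-binomial: the recurrences then need no condition on `q`,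
which enters only when returning to `qBinom`. -/
lemma qBinom_mul_qPoch {q : ℂ} {M n : ℕ} (hq : ∀ k : ℕ, 1 ≤ k → k ≤ M → q ^ (2 * k) ≠ 1)
    (h : n ≤ M) : qBinom (q ^ 2) M n * qPoch (q ^ 2) (q ^ 2) n = descPoch q M n := by
  have ne : ∀ k ≤ M, qPoch (q ^ 2) (q ^ 2) k ≠ 0 := fun k hk => qPoch_ne_zero fun i hi => by
    have := hq (i + 1) (by omega) (by omega)
    rwa [pow_mul, pow_succ'] at this
  have h1 := ne n h
  have h2 := ne (M - n) (by omega)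
  rw [qBinom, if_pos h, ← descPoch_mul_qPoch q h]
  field_simp

/-- The summand of index `m + 1` on the left of the finite Garvan identity. -/
noncomputable def leftTerm (q z : ℂ) (M m : ℕ) : ℂ :=
  descPoch q M (m + 1) * ((-1) ^ m * z ^ (m + 1) * q ^ ((m + 1) ^ 2)) /
    (qPoch (z * q) (q ^ 2) (m + 1) * (1 - z * q ^ (2 * m + 2)))

/-- The summand of index `m + 1` on the right of the finite Garvan identity, with its two parts
combined. -/
noncomputable def rightTerm (q z : ℂ) (M m : ℕ) : ℂ :=
  descPoch q M (m + 1) *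
      (qPoch q q (2 * m) * z ^ (2 * m + 1) * q ^ ((m + 1) * (2 * m + 1)) *
        (1 - z * q ^ (4 * m + 3))) /
    (qPoch (z * q) q (2 * m + 2) * qPoch (z * q ^ (2 * M + 1)) (q ^ 2) (m + 1))

/-- The telescoping certificate for `leftTerm`. -/
noncomputable def leftCert (q z : ℂ) (M m : ℕ) : ℂ :=
  descPoch q (M + 1) (m + 1) * ((-1) ^ m * z ^ (m + 1) * q ^ (2 * M + 1 + m ^ 2)) /
    (qPoch (z * q) (q ^ 2) m * (1 - z * q ^ (2 * M + 1)))

/-- The telescoping certificate for `rightTerm`. -/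
noncomputable def rightCert (q z : ℂ) (M m : ℕ) : ℂ :=
  descPoch q (M + 1) (m + 1) *
      (qPoch q q (2 * m) * z ^ (2 * m + 1) * q ^ (2 * M + 1 + 2 * m ^ 2 + m)) /
    (qPoch (z * q) q (2 * m) * qPoch (z * q ^ (2 * M + 1)) (q ^ 2) (m + 1))

lemma leftTerm_telescope {q z : ℂ} {M m : ℕ} (hm : m ≤ M)
    (hz : ∀ n : ℕ, 1 ≤ n → n ≤ 4 * M + 3 → z * q ^ n ≠ 1) :
    (1 - z * q ^ (2 * (M + 1))) * leftTerm q z (M + 1) m -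
        (1 - q ^ (2 * (M + 1))) * leftTerm q z M m =
      leftCert q z M m - leftCert q z M (m + 1) := by
  have hA : qPoch (z * q) (q ^ 2) m ≠ 0 := qPoch_ne_zero fun i hi => by
    have := hz (2 * i + 1) (by omega) (by omega)
    convert this using 1; ring
  have h1 : 1 - z * q ^ (2 * m + 1) ≠ 0 := sub_ne_zero.mpr (hz _ (by omega) (by omega)).symm
  have h2 : 1 - z * q ^ (2 * m + 2) ≠ 0 := sub_ne_zero.mpr (hz _ (by omega) (by omega)).symm
  have h3 : 1 - z * q ^ (2 * M + 1) ≠ 0 := sub_ne_zero.mpr (hz _ (by omega) (by omega)).symm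
  -- The factor `1 - q^(2(M+1))` raises `M` to `M + 1` in `descPoch`, so all four terms share one
  -- `descPoch` factor.
  have hu := descPoch_succ_left q M (m + 1)
  have key : (1 - q ^ (2 * (M + 1))) * leftTerm q z M m =
      descPoch q (M + 1) (m + 1) * (1 - q ^ (2 * (M + 1 - (m + 1)))) *
        ((-1) ^ m * z ^ (m + 1) * q ^ ((m + 1) ^ 2)) /
      (qPoch (z * q) (q ^ 2) (m + 1) * (1 - z * q ^ (2 * m + 2))) := by
    rw [leftTerm, ← hu]; ring
  rw [key, leftTerm, leftCert, leftCert, descPoch_succ q (M + 1) (m + 1), qPoch_succ]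
  -- Writing `M = m + d` removes the truncated subtraction, leaving a rational identity.
  obtain ⟨d, rfl⟩ := Nat.exists_eq_add_of_le hm
  have e : z * q * (q ^ 2) ^ m = z * q ^ (2 * m + 1) := by ring
  rw [e, show m + d + 1 - (m + 1) = d by omega]
  generalize descPoch q (m + d + 1) (m + 1) = u
  generalize qPoch (z * q) (q ^ 2) m = A at *
  field_simp
  ring

lemma rightTerm_telescope {q z : ℂ} {M m : ℕ} (hm : m ≤ M)
    (hz : ∀ n : ℕ, 1 ≤ n → n ≤ 4 * M + 3 → z * q ^ n ≠ 1) :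
    (1 - z * q ^ (2 * (M + 1))) * rightTerm q z (M + 1) m -
        (1 - q ^ (2 * (M + 1))) * rightTerm q z M m =
      rightCert q z M m - rightCert q z M (m + 1) := by
  have hA : qPoch (z * q) q (2 * m) ≠ 0 := qPoch_ne_zero fun i hi => by
    have := hz (i + 1) (by omega) (by omega)
    convert this using 1; ring
  have hB : qPoch (z * q ^ (2 * M + 1)) (q ^ 2) (m + 1) ≠ 0 := qPoch_ne_zero fun i hi => by
    have := hz (2 * M + 1 + 2 * i) (by omega) (by omega)
    convert this using 1; ring
  have h1 : 1 - z * q ^ (2 * m + 1) ≠ 0 := sub_ne_zero.mpr (hz _ (by omega) (by omega)).symm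
  have h2 : 1 - z * q ^ (2 * m + 2) ≠ 0 := sub_ne_zero.mpr (hz _ (by omega) (by omega)).symm
  have h3 : 1 - z * q ^ (2 * M + 1) ≠ 0 := sub_ne_zero.mpr (hz _ (by omega) (by omega)).symm
  -- At `m = M` this exponent is `4M + 3`, the top of the range assumed in `hz`.
  have h4 : 1 - z * q ^ (2 * M + 2 * m + 3) ≠ 0 :=
    sub_ne_zero.mpr (hz _ (by omega) (by omega)).symm
  have hC : qPoch (z * q ^ (2 * (M + 1) + 1)) (q ^ 2) (m + 1) =
      qPoch (z * q ^ (2 * M + 1)) (q ^ 2) (m + 1) * (1 - z * q ^ (2 * M + 2 * m + 3)) /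
        (1 - z * q ^ (2 * M + 1)) := by
    rw [eq_div_iff h3, mul_comm]
    have := qPoch_mul_shift (z * q ^ (2 * M + 1)) (q ^ 2) (m + 1)
    convert this.symm using 2
    · congr 1; ring
    · ring
  have hu := descPoch_succ_left q M (m + 1)
  have key : (1 - q ^ (2 * (M + 1))) * rightTerm q z M m =
      descPoch q (M + 1) (m + 1) * (1 - q ^ (2 * (M + 1 - (m + 1)))) *
        (qPoch q q (2 * m) * z ^ (2 * m + 1) * q ^ ((m + 1) * (2 * m + 1)) *
          (1 - z * q ^ (4 * m + 3))) /
      (qPoch (z * q) q (2 * m + 2) * qPoch (z * q ^ (2 * M + 1)) (q ^ 2) (m + 1)) := by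
    rw [rightTerm, ← hu]; ring
  rw [key, rightTerm, rightCert, rightCert, hC, descPoch_succ q (M + 1) (m + 1),
    show 2 * (m + 1) = 2 * m + 1 + 1 by ring, qPoch_succ _ _ (2 * m + 1), qPoch_succ _ _ (2 * m),
    qPoch_succ q _ (2 * m + 1), qPoch_succ q _ (2 * m), qPoch_succ _ (q ^ 2) (m + 1)]
  obtain ⟨d, rfl⟩ := Nat.exists_eq_add_of_le hm
  have e1 : z * q * q ^ (2 * m) = z * q ^ (2 * m + 1) := by ring
  have e2 : z * q * q ^ (2 * m + 1) = z * q ^ (2 * m + 2) := by ring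
  have e3 : z * q ^ (2 * (m + d) + 1) * (q ^ 2) ^ (m + 1) =
    z * q ^ (2 * (m + d) + 2 * m + 3) := by ring
  rw [e1, e2, e3, show m + d + 1 - (m + 1) = d by omega]
  generalize descPoch q (m + d + 1) (m + 1) = u
  generalize qPoch (z * q) q (2 * m) = A at *
  generalize qPoch q q (2 * m) = P at *
  generalize qPoch (z * q ^ (2 * (m + d) + 1)) (q ^ 2) (m + 1) = B at *
  field_simp
  ring

/-- Both equal `(1 - q^(2(M+1))) z q^(2M+1) / (1 - z q^(2M+1))`, the common inhomogeneous term. -/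
lemma leftCert_zero (q z : ℂ) (M : ℕ) : leftCert q z M 0 = rightCert q z M 0 := by
  simp [leftCert, rightCert, qPoch_zero, qPoch_succ]

lemma descPoch_eq_zero (q : ℂ) (M : ℕ) : descPoch q M (M + 1) = 0 := by
  simp [descPoch_succ]

lemma sum_leftTerm_eq_sum_rightTerm {q z : ℂ} (N : ℕ)
    (hz : ∀ n : ℕ, 1 ≤ n → n ≤ 4 * N - 1 → z * q ^ n ≠ 1) :
    ∑ m ∈ Finset.range N, leftTerm q z N m = ∑ m ∈ Finset.range N, rightTerm q z N m := by
  induction N with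
  | zero => simp
  | succ M ih =>
    have hz' : ∀ n : ℕ, 1 ≤ n → n ≤ 4 * M + 3 → z * q ^ n ≠ 1 :=
      fun n h1 h2 => hz n h1 (by omega)
    have IH := ih fun n h1 h2 => hz n h1 (by omega)
    have hne : 1 - z * q ^ (2 * (M + 1)) ≠ 0 :=
      sub_ne_zero.mpr (hz _ (by omega) (by omega)).symm
    have hL := Finset.sum_congr rfl fun m (hm : m ∈ Finset.range (M + 1)) =>
      leftTerm_telescope (Nat.lt_succ_iff.mp (Finset.mem_range.mp hm)) hz'
    have hR := Finset.sum_congr rfl fun m (hm : m ∈ Finset.range (M + 1)) =>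
      rightTerm_telescope (Nat.lt_succ_iff.mp (Finset.mem_range.mp hm)) hz'
    have l0 : leftCert q z M (M + 1) = 0 := by simp [leftCert, descPoch_eq_zero]
    have r0 : rightCert q z M (M + 1) = 0 := by simp [rightCert, descPoch_eq_zero]
    -- The sums for `M` also run over `range (M + 1)`; their extra last term is zero.
    have l1 : leftTerm q z M M = 0 := by simp [leftTerm, descPoch_eq_zero]
    have r1 : rightTerm q z M M = 0 := by simp [rightTerm, descPoch_eq_zero]
    rw [Finset.sum_range_sub', Finset.sum_sub_distrib, ← Finset.mul_sum, ← Finset.mul_sum] at hL hR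
    rw [l0, Finset.sum_range_succ (leftTerm q z M), l1, leftCert_zero] at hL
    rw [r0, Finset.sum_range_succ (rightTerm q z M), r1, ← IH] at hR
    exact mul_left_cancel₀ hne (by linear_combination hL - hR)

lemma sum_Icc_one_eq_sum_range (f : ℕ → ℂ) (N : ℕ) :
    ∑ n ∈ Finset.Icc 1 N, f n = ∑ m ∈ Finset.range N, f (m + 1) := by
  induction N with
  | zero => simp
  | succ N ih => rw [Finset.sum_Icc_succ_top (by omega), Finset.sum_range_succ, ih]

theorem mainTheorem6 (N : ℕ) (q z : ℂ)
    (hq : ∀ k : ℕ, 1 ≤ k → k ≤ N → q ^ (2 * k) ≠ 1)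
    (hz : ∀ n : ℕ, 1 ≤ n → n ≤ 4 * N - 1 → z * q ^ n ≠ 1) :
    ∑ n ∈ Finset.Icc 1 N, qBinom (q ^ 2) N n *
        ((-1) ^ (n - 1) * z ^ n * q ^ (n ^ 2) * qPoch (q ^ 2) (q ^ 2) n /
          (qPoch (z * q) (q ^ 2) n * (1 - z * q ^ (2 * n)))) =
      ∑ n ∈ Finset.Icc 1 N, qBinom (q ^ 2) N n *
        (qPoch q q (2 * n - 2) * z ^ (2 * n - 1) * q ^ (n * (2 * n - 1)) /
            qPoch (z * q) q (2 * n - 1) +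
          qPoch q q (2 * n - 1) * z ^ (2 * n) * q ^ (n * (2 * n + 1)) /
            qPoch (z * q) q (2 * n)) *
        (qPoch (q ^ 2) (q ^ 2) n / qPoch (z * q ^ (2 * N + 1)) (q ^ 2) n) := by
  rw [sum_Icc_one_eq_sum_range, sum_Icc_one_eq_sum_range]
  convert sum_leftTerm_eq_sum_rightTerm N hz using 1
  · refine Finset.sum_congr rfl fun m hm => ?_
    rw [leftTerm, ← qBinom_mul_qPoch hq (Finset.mem_range.mp hm), Nat.add_sub_cancel]
    ring
  · refine Finset.sum_congr rfl fun m hm => ?_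
    have hm' := Finset.mem_range.mp hm
    have hA : qPoch (z * q) q (2 * m) ≠ 0 := qPoch_ne_zero fun i hi => by
      have := hz (i + 1) (by omega) (by omega)
      convert this using 1; ring
    have h1 : 1 - z * q ^ (2 * m + 1) ≠ 0 := sub_ne_zero.mpr (hz _ (by omega) (by omega)).symm
    have h2 : 1 - z * q ^ (2 * m + 2) ≠ 0 := sub_ne_zero.mpr (hz _ (by omega) (by omega)).symm
    have e1 : z * q * q ^ (2 * m) = z * q ^ (2 * m + 1) := by ring
    have e2 : z * q * q ^ (2 * m + 1) = z * q ^ (2 * m + 2) := by ring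
    rw [rightTerm, ← qBinom_mul_qPoch hq hm', show 2 * (m + 1) - 2 = 2 * m by omega,
      show 2 * (m + 1) - 1 = 2 * m + 1 by omega, show 2 * (m + 1) = 2 * m + 1 + 1 by ring,
      show 2 * m + 2 = 2 * m + 1 + 1 by ring, qPoch_succ _ _ (2 * m + 1), qPoch_succ _ _ (2 * m),
      qPoch_succ q _ (2 * m), e1, e2]
    generalize qBinom (q ^ 2) N (m + 1) = b
    generalize qPoch (z * q) q (2 * m) = A at *
    rw [mul_div_assoc', ← div_div _ _ (qPoch (z * q ^ (2 * N + 1)) (q ^ 2) (m + 1))]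
    -- The two parts combine through `(1 - z q^(2m+2)) + z q^(2m+2) (1 - q^(2m+1)) = 1 - z
    -- q^(4m+3)`.
    congr 1
    field_simp
    ring
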